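/- Let $(X,\mathcal M,\mu)$ be a probability space and let $T:X\to X$ be an invertible measure-preserving transformation, that is, a bijection such that $T$ and $T^{-1}$ are measurable and $\mu(T^{-1}B)=\mu(B)$ for all $B\in\mathcal M$. Let $A\in\mathcal M$, and let $P_1,\dots,P_\ell\in\mathbb Z[n]$ be polynomials with $P_i(0)=0$ for all $1\le i\le\ell$ (they need not be linearly independent or of equal degree). Then for every $\varepsilon>0$ there exists an integer $n\ge 1$ such that $$\mu\bigl(A\cap T^{-P_i(n)}A\bigr)>\mu(A)^2-\varepsilon\qquad\text{for all } 1\le i\le\ell .$$ -/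

import Mathlib

open Filter Topology

attribute [local instance] Ultrafilter.add Ultrafilter.addSemigroup

/-! Let `U` be the Koopman operator on L², `f` the indicator of `A`, `e` the constant 1. Fix an
idempotent ultrafilter `p` on ℤ whose members all have positive mass for a shift-invariant mean, and
let K be the closed space of `x` with `U ^ n x → x` along `p`.

For an integer polynomial q ≠ 0 with q(0) = 0, `U ^ q(n)` tends along `p` to the identity on K
(`tendsto_zpow_eval`, by precompactness of orbits) and weakly to 0 on Kᗮ
(`tendsto_inner_zpow_eval_zero`, by van der Corput). So ⟪U^q(n) f, f⟫ tends to the squared norm of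
the projection of f to K, which is at least ⟪e, f⟫² = μ(A)² because e ∈ K. Finitely many sets of `p`
meet in a set of `p`, whence one n serves all the polynomials. -/

/-- The proportion of `{0, …, N}` occupied by `A`. -/
noncomputable def initialDensity (A : Set ℤ) (N : ℕ) : ℝ :=
  (∑ i ∈ Finset.range (N + 1), A.indicator (fun _ => (1 : ℝ)) (i : ℤ)) / (N + 1)

lemma initialDensity_mem_Icc (A : Set ℤ) (N : ℕ) : initialDensity A N ∈ Set.Icc (0 : ℝ) 1 := by
  have h0 : ∀ i : ℤ, 0 ≤ A.indicator (fun _ => (1 : ℝ)) i := fun i =>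
    Set.indicator_nonneg (fun _ _ => zero_le_one) i
  have h1 : ∀ i : ℤ, A.indicator (fun _ => (1 : ℝ)) i ≤ 1 := fun i =>
    Set.indicator_le_self' (fun _ _ => zero_le_one) i
  refine ⟨div_nonneg (Finset.sum_nonneg fun i _ => h0 i) (by positivity), ?_⟩
  rw [initialDensity, div_le_one (by positivity)]
  calc _ ≤ ∑ i ∈ Finset.range (N + 1), (1 : ℝ) := Finset.sum_le_sum fun i _ => h1 i
    _ = N + 1 := by simp

lemma abs_initialDensity_shift_sub_le (A : Set ℤ) (N : ℕ) :
    |initialDensity {n | n + 1 ∈ A} N - initialDensity A N| ≤ 1 / (N + 1) := by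
  have key : initialDensity {n | n + 1 ∈ A} N - initialDensity A N =
      (A.indicator (fun _ => (1 : ℝ)) ((N : ℤ) + 1) - A.indicator (fun _ => (1 : ℝ)) 0) /
        (N + 1) := by
    rw [initialDensity, initialDensity, ← sub_div, ← Finset.sum_sub_distrib]
    congr 1
    have := Finset.sum_range_sub (fun i : ℕ => A.indicator (fun _ => (1 : ℝ)) (i : ℤ)) (N + 1)
    push_cast at this
    rw [← this]
    rfl
  rw [key, abs_div, abs_of_pos (by positivity : (0 : ℝ) < N + 1)]
  gcongr
  by_cases h : ((N : ℤ) + 1) ∈ A <;> by_cases h' : (0 : ℤ) ∈ A <;> simp [h, h']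

/-- A shift-invariant finitely additive probability on `ℤ` vanishing on the nonpositive
integers. -/
structure IsShiftInvariantMean (m : Set ℤ → ℝ) : Prop where
  nonneg : ∀ A, 0 ≤ m A
  univ : m Set.univ = 1
  union : ∀ A B, Disjoint A B → m (A ∪ B) = m A + m B
  shift : ∀ A (t : ℤ), m {n | n + t ∈ A} = m A
  nonpos : m (Set.Iic 0) = 0

lemma exists_isShiftInvariantMean : ∃ m, IsShiftInvariantMean m := by
  have hlim : ∀ A : Set ℤ, ∃ a ∈ Set.Icc (0 : ℝ) 1,
      Tendsto (initialDensity A) (hyperfilter ℕ) (𝓝 a) := fun A =>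
    isCompact_Icc.ultrafilter_le_nhds ((hyperfilter ℕ).map (initialDensity A))
      (by
        rw [le_principal_iff]
        exact Filter.mem_map.2 (Filter.Eventually.of_forall fun N => initialDensity_mem_Icc A N))
  choose m hm hmt using hlim
  have hle : (hyperfilter ℕ : Filter ℕ) ≤ atTop := by
    rw [← Nat.cofinite_eq_atTop]; exact hyperfilter_le_cofinite
  have hz : Tendsto (fun N : ℕ => 1 / ((N : ℝ) + 1)) (hyperfilter ℕ) (𝓝 0) :=
    tendsto_one_div_add_atTop_nhds_zero_nat.mono_left hle
  have hshift : ∀ A, m {n | n + 1 ∈ A} = m A := fun A => by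
    have h := squeeze_zero_norm (f := fun N => initialDensity {n | n + 1 ∈ A} N - initialDensity A N)
      (fun N => abs_initialDensity_shift_sub_le A N) hz
    have h' := (hmt {n | n + 1 ∈ A}).sub (hmt A)
    linarith [tendsto_nhds_unique h h']
  refine ⟨m, fun A => (hm A).1, ?_, fun A B hAB => ?_, fun A t => ?_, ?_⟩
  · refine tendsto_nhds_unique (hmt _) (tendsto_const_nhds.congr fun N => ?_)
    have : (N : ℝ) + 1 ≠ 0 := by positivity
    simp [initialDensity, this]
  · refine tendsto_nhds_unique (hmt _) (((hmt A).add (hmt B)).congr fun N => ?_)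
    rw [initialDensity, initialDensity, initialDensity, ← add_div, ← Finset.sum_add_distrib,
      Set.indicator_union_of_disjoint hAB]
  · induction t with
    | zero => simp
    | succ i ih =>
      rw [← ih, ← hshift {n | n + (i : ℤ) ∈ A}]
      congr 1; ext n
      simp only [Set.mem_ofPred_eq]
      rw [show n + 1 + (i : ℤ) = n + ((i : ℤ) + 1) by ring]
    | pred i ih =>
      rw [← ih, ← hshift {n | n + (-(i : ℤ) - 1) ∈ A}]
      congr 1; ext n
      simp only [Set.mem_ofPred_eq]
      rw [show n + 1 + (-(i : ℤ) - 1) = n + -(i : ℤ) by ring]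
  · refine tendsto_nhds_unique (hmt _) (hz.congr fun N => ?_)
    rw [initialDensity]
    congr 1
    rw [Finset.sum_range_succ', Finset.sum_eq_zero]
    · simp
    · intro i _
      refine Set.indicator_of_notMem ?_ _
      simp only [Set.mem_Iic, not_le]; positivity

namespace IsShiftInvariantMean

variable {m : Set ℤ → ℝ}

lemma mono (hm : IsShiftInvariantMean m) {A B : Set ℤ} (h : A ⊆ B) : m A ≤ m B := by
  have := hm.union A (B \ A) Set.disjoint_sdiff_right
  rw [Set.union_sdiff_cancel h] at this
  linarith [hm.nonneg (B \ A)]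

lemma union_le (hm : IsShiftInvariantMean m) (A B : Set ℤ) : m (A ∪ B) ≤ m A + m B := by
  have := hm.union A (B \ A) Set.disjoint_sdiff_right
  rw [Set.union_sdiff_self] at this
  linarith [hm.mono (Set.sdiff_subset : B \ A ⊆ B)]

lemma eq_zero_of_bddAbove (hm : IsShiftInvariantMean m) {A : Set ℤ} (h : BddAbove A) : m A = 0 := by
  obtain ⟨M, hM⟩ := h
  refine le_antisymm ?_ (hm.nonneg A)
  rw [← hm.shift A M, ← hm.nonpos]
  refine hm.mono fun n hn => ?_
  have := hM hn
  simp only [Set.mem_Iic]; omega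

lemma biUnion (hm : IsShiftInvariantMean m) (F : Finset ℤ) (f : ℤ → Set ℤ)
    (hf : (F : Set ℤ).PairwiseDisjoint f) : m (⋃ t ∈ F, f t) = ∑ t ∈ F, m (f t) := by
  classical
  induction F using Finset.induction_on with
  | empty => simpa using hm.eq_zero_of_bddAbove bddAbove_empty
  | insert a s ha ih =>
    rw [Finset.set_biUnion_insert, Finset.sum_insert ha, hm.union, ih]
    · exact hf.subset (by simp)
    · rw [Set.disjoint_iUnion₂_right]
      intro t ht
      exact hf (by simp) (by simp [ht]) (by rintro rfl; exact ha ht)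

lemma card_mul_le_one (hm : IsShiftInvariantMean m) (S : Set ℤ) (F : Finset ℤ)
    (hF : (F : Set ℤ).PairwiseDisjoint fun t => {n | n + t ∈ S}) : F.card * m S ≤ 1 := by
  have h := hm.biUnion F _ hF
  simp only [hm.shift, Finset.sum_const, nsmul_eq_mul] at h
  rw [← h, ← hm.univ]
  exact hm.mono (Set.subset_univ _)

end IsShiftInvariantMean

/-! ### Essential idempotent ultrafilters -/

/-- An idempotent ultrafilter on `ℤ` all of whose members are unbounded above and admit only
boundedly many pairwise disjoint translates. -/
structure IsEssentialIdempotent (p : Ultrafilter ℤ) : Prop where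
  eventually_add : ∀ {P : ℤ → Prop}, (∀ᶠ n in p, P n) → ∀ᶠ m in p, ∀ᶠ n in p, P (m + n)
  not_bddAbove : ∀ {S : Set ℤ}, S ∈ p → ¬ BddAbove S
  card_le : ∀ {S : Set ℤ}, S ∈ p → ∃ C : ℕ, ∀ F : Finset ℤ,
    (F : Set ℤ).PairwiseDisjoint (fun t => {n | n + t ∈ S}) → F.card ≤ C

/-- The ultrafilters with all members of positive mean form a nonempty compact subsemigroup, so
Ellis's theorem gives an idempotent. Disjoint translates have equal mean and total at most 1, which
bounds their number. -/
lemma exists_isEssentialIdempotent : ∃ p : Ultrafilter ℤ, IsEssentialIdempotent p := by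
  obtain ⟨m, hm⟩ := exists_isShiftInvariantMean
  let E : Set (Ultrafilter ℤ) := {p | ∀ S ∈ p, 0 < m S}
  have hne : E.Nonempty := by
    let f : Filter ℤ :=
      { sets := {A | m Aᶜ = 0}
        univ_sets := by simpa using hm.eq_zero_of_bddAbove bddAbove_empty
        sets_of_superset := fun {A B} hA hAB =>
          le_antisymm ((hm.mono (Set.compl_subset_compl.2 hAB)).trans hA.le) (hm.nonneg _)
        inter_sets := fun {A B} hA hB => by
          refine le_antisymm ?_ (hm.nonneg _)
          rw [Set.compl_inter]
          refine (hm.union_le _ _).trans ?_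
          have hA' : m Aᶜ = 0 := hA
          have hB' : m Bᶜ = 0 := hB
          rw [hA', hB', add_zero] }
    have hf : f.NeBot := by
      refine ⟨fun h => ?_⟩
      have : (∅ : Set ℤ) ∈ f := by rw [h]; trivial
      have h0 : m (∅ : Set ℤ)ᶜ = 0 := this
      rw [Set.compl_empty, hm.univ] at h0
      exact one_ne_zero h0
    refine ⟨Ultrafilter.of f, fun S hS => (hm.nonneg S).lt_of_ne fun h => ?_⟩
    have : Sᶜ ∈ f := by
      change m Sᶜᶜ = 0
      rw [compl_compl, ← h]
    exact Ultrafilter.compl_notMem_iff.2 hS (Ultrafilter.of_le f this)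
  have hcl : IsClosed E := by
    have : E = ⋂ S ∈ {S | ¬ 0 < m S}, {p : Ultrafilter ℤ | S ∈ p}ᶜ := by
      ext p
      simp only [E, Set.mem_iInter, Set.mem_ofPred_eq, Set.mem_compl_iff]
      exact forall_congr' fun S => not_imp_not.symm
    rw [this]
    exact isClosed_biInter fun S _ => (ultrafilter_isOpen_basic S).isClosed_compl
  obtain ⟨p, hpE, hp⟩ := exists_idempotent_in_compact_add_subsemigroup
    (M := Ultrafilter ℤ) Ultrafilter.continuous_add_left E hne hcl.isCompact (by
      intro p hp q hq S hS
      have h : ∀ᶠ a in p, ∀ᶠ b in q, a + b ∈ S := (Ultrafilter.eventually_add p q (· ∈ S)).1 hS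
      obtain ⟨a, ha⟩ := h.exists
      -- Only q ∈ E matters: some translate of S lies in q, and translates have equal mean.
      have h2 := hq _ ha
      simp only [add_comm a] at h2
      rwa [← hm.shift S a])
  refine ⟨p, fun {P} h => ?_, fun {S} hS hb => ?_, fun {S} hS => ?_⟩
  · rw [← hp] at h
    exact (Ultrafilter.eventually_add p p P).1 h
  · exact (hpE S hS).ne' (hm.eq_zero_of_bddAbove hb)
  · have hpos := hpE S hS
    refine ⟨⌊1 / m S⌋₊, fun F hF => Nat.le_floor ?_⟩
    rw [le_div_iff₀ hpos]
    exact hm.card_mul_le_one S F hF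

/-! ### Unitary powers along an essential idempotent -/

section HilbertSpace

open Polynomial RealInnerProductSpace

variable {H : Type*} [NormedAddCommGroup H] [InnerProductSpace ℝ H]

lemma LinearIsometryEquiv.zpow_add_apply (U : H ≃ₗᵢ[ℝ] H) (a b : ℤ) (x : H) :
    (U ^ (a + b)) x = (U ^ a) ((U ^ b) x) := by
  rw [zpow_add]; rfl

lemma LinearIsometryEquiv.zpow_mul_apply (U : H ≃ₗᵢ[ℝ] H) (a b : ℤ) (x : H) :
    (U ^ (a * b)) x = ((U ^ a) ^ b) x := by
  rw [zpow_mul]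

lemma LinearIsometryEquiv.inner_zpow_left (U : H ≃ₗᵢ[ℝ] H) (a : ℤ) (x y : H) :
    ⟪(U ^ a) x, y⟫ = ⟪x, (U ^ (-a)) y⟫ := by
  rw [zpow_neg]
  exact (U ^ a).inner_map_eq_flip x y

lemma Ultrafilter.exists_tendsto_of_abs_le {ι : Type*} (p : Ultrafilter ι) {f : ι → ℝ} {C : ℝ}
    (hf : ∀ n, |f n| ≤ C) : ∃ L, |L| ≤ C ∧ Tendsto f p (𝓝 L) := by
  obtain ⟨L, hL, h⟩ := (isCompact_Icc (a := -C) (b := C)).ultrafilter_le_nhds (p.map f) (by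
    rw [le_principal_iff]
    exact Filter.mem_map.2 (Filter.Eventually.of_forall fun n => abs_le.1 (hf n)))
  exact ⟨L, abs_le.2 hL, h⟩

lemma Ultrafilter.exists_tendsto_inner [CompleteSpace H] {ι : Type*} (p : Ultrafilter ι)
    {v : ι → H} {C : ℝ} (hv : ∀ n, ‖v n‖ ≤ C) :
    ∃ y, ∀ z, Tendsto (fun n => ⟪v n, z⟫) p (𝓝 ⟪y, z⟫) := by
  have hlim : ∀ z, ∃ L, |L| ≤ C * ‖z‖ ∧ Tendsto (fun n => ⟪v n, z⟫) p (𝓝 L) := fun z =>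
    p.exists_tendsto_of_abs_le fun n => (abs_real_inner_le_norm _ _).trans
      (mul_le_mul_of_nonneg_right (hv n) (norm_nonneg z))
  choose L hL hLt using hlim
  let φ : H →ₗ[ℝ] ℝ :=
    { toFun := L
      map_add' := fun x y => tendsto_nhds_unique (hLt _)
        (by simpa only [inner_add_right] using (hLt x).add (hLt y))
      map_smul' := fun c x => tendsto_nhds_unique (hLt _)
        (by simpa only [inner_smul_right, smul_eq_mul, RingHom.id_apply] using (hLt x).const_mul c) }
  refine ⟨(InnerProductSpace.toDual ℝ H).symm (φ.mkContinuous C hL), fun z => ?_⟩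
  rw [InnerProductSpace.toDual_symm_apply]
  exact hLt z

namespace IsEssentialIdempotent

variable {p : Ultrafilter ℤ}

lemma infinite (hp : IsEssentialIdempotent p) {S : Set ℤ} (hS : S ∈ p) : S.Infinite :=
  fun h => hp.not_bddAbove hS h.bddAbove

/-- A van der Corput lemma along an ultrafilter. -/
lemma tendsto_inner_zero_of_correlations (hp : IsEssentialIdempotent p) {v : ℤ → H} {C : ℝ}
    (hv : ∀ n, ‖v n‖ ≤ C)
    (h : ∀ a b, a ≠ b → Tendsto (fun n => ⟪v (a + n), v (b + n)⟫) p (𝓝 0)) (z : H) :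
    Tendsto (fun n => ⟪v n, z⟫) p (𝓝 0) := by
  obtain ⟨L, -, hL⟩ := p.exists_tendsto_of_abs_le (f := fun n => ⟪v n, z⟫) (C := C * ‖z‖)
    fun n => (abs_real_inner_le_norm _ _).trans
      (mul_le_mul_of_nonneg_right (hv n) (norm_nonneg z))
  suffices L = 0 by rwa [this] at hL
  by_contra hL0
  have hLpos : 0 < |L| := abs_pos.2 hL0
  have hev : ∀ᶠ n in p, |⟪v n, z⟫ - L| < |L| / 2 := by
    simpa only [Real.dist_eq] using Metric.tendsto_nhds.1 hL _ (half_pos hLpos)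
  have hinf := hp.infinite (hp.eventually_add hev)
  -- For a sum w of N translates, |⟪w, z⟫| ≥ N|L|/2 while ‖w‖² ≤ N(C² + 1); Cauchy–Schwarz fails for
  -- this N.
  obtain ⟨N, hN⟩ := exists_nat_gt (‖z‖ ^ 2 * (C ^ 2 + 1) / (|L| / 2) ^ 2)
  have hN0 : (0 : ℝ) < N := lt_of_le_of_lt (by positivity) hN
  obtain ⟨F, hF, hFN⟩ := hinf.exists_subset_card_eq N
  have h1 : ∀ᶠ n in p, ∀ t ∈ F, |⟪v (t + n), z⟫ - L| < |L| / 2 :=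
    (Filter.eventually_all_finset F).2 fun t ht => hF ht
  have h2 : ∀ᶠ n in p, ∀ a ∈ F, ∀ b ∈ F, a ≠ b → ⟪v (a + n), v (b + n)⟫ < 1 / (N : ℝ) := by
    refine (Filter.eventually_all_finset F).2 fun a _ => (Filter.eventually_all_finset F).2
      fun b _ => ?_
    by_cases hab : a = b
    · simp [hab]
    · exact ((h a b hab).eventually_lt_const (by positivity)).mono fun n hn _ => hn
  obtain ⟨n, hn1, hn2⟩ := (h1.and h2).exists
  set w := ∑ t ∈ F, v (t + n) with hw
  have hwz : N * (|L| / 2) ≤ |⟪w, z⟫| := by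
    have e : |⟪w, z⟫ - N * L| ≤ N * (|L| / 2) := by
      have : ⟪w, z⟫ - N * L = ∑ t ∈ F, (⟪v (t + n), z⟫ - L) := by
        rw [hw, sum_inner, Finset.sum_sub_distrib, Finset.sum_const, hFN, nsmul_eq_mul]
      rw [this, ← hFN, ← nsmul_eq_mul]
      exact (Finset.abs_sum_le_sum_abs _ _).trans
        (Finset.sum_le_card_nsmul _ _ _ fun t ht => (hn1 t ht).le)
    have e2 := abs_sub_abs_le_abs_sub (N * L) ⟪w, z⟫
    rw [abs_sub_comm, abs_mul, abs_of_pos hN0] at e2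
    linarith
  have hww : ‖w‖ ^ 2 ≤ N * (C ^ 2 + 1) := by
    rw [← real_inner_self_eq_norm_sq, hw, sum_inner, ← hFN, ← nsmul_eq_mul]
    refine Finset.sum_le_card_nsmul _ _ _ fun a ha => ?_
    rw [inner_sum, ← Finset.add_sum_erase _ _ ha]
    refine add_le_add ?_ ?_
    · rw [real_inner_self_eq_norm_sq]
      exact pow_le_pow_left₀ (norm_nonneg _) (hv _) 2
    · calc _ ≤ ∑ b ∈ F.erase a, 1 / (N : ℝ) := Finset.sum_le_sum fun b hb =>
            (hn2 a ha b (Finset.mem_of_mem_erase hb) (Finset.ne_of_mem_erase hb).symm).le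
        _ ≤ ∑ b ∈ F, 1 / (N : ℝ) :=
            Finset.sum_le_sum_of_subset_of_nonneg (Finset.erase_subset _ _)
              fun _ _ _ => by positivity
        _ = 1 := by
            rw [Finset.sum_const, hFN, nsmul_eq_mul, mul_one_div, div_self hN0.ne']
  have h3 : (N * (|L| / 2)) ^ 2 ≤ N * (C ^ 2 + 1) * ‖z‖ ^ 2 := by
    calc _ ≤ |⟪w, z⟫| ^ 2 := pow_le_pow_left₀ (by positivity) hwz 2
      _ ≤ (‖w‖ * ‖z‖) ^ 2 :=
          pow_le_pow_left₀ (abs_nonneg _) (abs_real_inner_le_norm _ _) 2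
      _ = ‖w‖ ^ 2 * ‖z‖ ^ 2 := mul_pow _ _ _
      _ ≤ _ := mul_le_mul_of_nonneg_right hww (by positivity)
  rw [div_lt_iff₀ (by positivity)] at hN
  have h4 := mul_lt_mul_of_pos_left hN hN0
  nlinarith

/-- Otherwise the orbit has arbitrarily large ε-separated finite subsets. Their exponents translate
the set of ε/2-return times to disjoint sets, contradicting `card_le`. -/
lemma totallyBounded_orbit (hp : IsEssentialIdempotent p) (U : H ≃ₗᵢ[ℝ] H) {x : H}
    (hx : Tendsto (fun n : ℤ => (U ^ n) x) p (𝓝 x)) :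
    TotallyBounded (Set.range fun n : ℤ => (U ^ n) x) := by
  rw [Metric.totallyBounded_iff]
  by_contra! ⟨ε, hε, hcover⟩
  obtain ⟨C, hC⟩ := hp.card_le (Metric.tendsto_nhds.1 hx _ (half_pos hε))
  have hsep : ∀ k : ℕ, ∃ F : Finset ℤ, F.card = k ∧
      ∀ s ∈ F, ∀ t ∈ F, s ≠ t → ε ≤ dist ((U ^ s) x) ((U ^ t) x) := by
    intro k
    induction k with
    | zero => exact ⟨∅, by simp⟩
    | succ k ih =>
      obtain ⟨F, hFk, hF⟩ := ih
      obtain ⟨_, ⟨t, rfl⟩, ht⟩ := Set.not_subset.1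
        (hcover ((fun n : ℤ => (U ^ n) x) '' F) (F.finite_toSet.image _))
      simp only [Set.mem_iUnion, Set.mem_image, Finset.mem_coe, Metric.mem_ball, exists_prop,
        exists_exists_and_eq_and, not_exists, not_and, not_lt] at ht
      have htF : t ∉ F := fun h => by simpa [hε.not_ge] using ht t h
      refine ⟨insert t F, by rw [Finset.card_insert_of_notMem htF, hFk], ?_⟩
      intro a ha b hb hab
      rcases Finset.mem_insert.1 ha with rfl | ha' <;> rcases Finset.mem_insert.1 hb with rfl | hb'
      · exact absurd rfl hab
      · exact ht b hb'
      · rw [dist_comm]; exact ht a ha'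
      · exact hF a ha' b hb' hab
  obtain ⟨F, hFC, hF⟩ := hsep (C + 1)
  have := hC F fun s hs t ht hst => Set.disjoint_left.2 fun n hns hnt => by
    have key : ∀ r : ℤ, dist ((U ^ (n + r)) x) x < ε / 2 →
        dist ((U ^ (-n)) x) ((U ^ r) x) < ε / 2 := fun r hr => by
      rw [← (U ^ n).dist_map, ← U.zpow_add_apply, ← U.zpow_add_apply, dist_comm]
      simpa using hr
    have h1 := key s hns
    have h2 := key t hnt
    rw [dist_comm] at h1
    linarith [hF s hs t ht hst, dist_triangle ((U ^ s) x) ((U ^ (-n)) x) ((U ^ t) x)]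
  omega

lemma natDegree_taylor_sub_taylor_lt {q : ℤ[X]} (hq : 0 < q.natDegree) (a b : ℤ) :
    (taylor a q - taylor b q).natDegree < q.natDegree := by
  have h0 : taylor a q ≠ 0 := by
    rw [Ne, taylor_eq_zero]; rintro rfl; simp at hq
  by_cases h : taylor a q - taylor b q = 0
  · simpa [h] using hq
  rw [← natDegree_taylor q a]
  refine natDegree_lt_natDegree h (degree_sub_lt_left ?_ h0 ?_)
  · rw [degree_taylor, degree_taylor]
  · rw [leadingCoeff_taylor, leadingCoeff_taylor]

/-- If q has degree d + 1, the coefficient of degree d in the difference is (d + 1)(a − b) times the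
leading coefficient of q. -/
lemma natDegree_taylor_sub_taylor_pos {q : ℤ[X]} (hq : 2 ≤ q.natDegree) {a b : ℤ} (hab : a ≠ b) :
    0 < (taylor a q - taylor b q).natDegree := by
  obtain ⟨d, hd⟩ : ∃ d, q.natDegree = d + 1 := ⟨q.natDegree - 1, by omega⟩
  refine lt_of_lt_of_le (by omega : 0 < d) (le_natDegree_of_ne_zero ?_)
  have hle : (hasseDeriv d q).natDegree < 2 := by
    have := natDegree_hasseDeriv_le q d
    omega
  rw [coeff_sub, taylor_coeff, taylor_coeff, eval_eq_sum_range' hle, eval_eq_sum_range' hle]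
  simp only [Finset.sum_range_succ, Finset.sum_range_zero, hasseDeriv_coeff]
  have hlc : q.coeff (1 + d) ≠ 0 := by
    rw [add_comm, ← hd]; exact leadingCoeff_ne_zero.2 (by rintro rfl; simp at hq)
  have hch : (((1 + d).choose d : ℕ) : ℤ) ≠ 0 := by
    exact_mod_cast (Nat.choose_pos (by omega)).ne'
  have := mul_ne_zero (mul_ne_zero hch hlc) (sub_ne_zero.2 hab)
  intro h
  apply this
  linear_combination h

/-- Induct on degree, writing q(m + n) = q(m) + q(n) + r(n) with r of lower degree and r(0) = 0.
Precompactness gives a limit y; by idempotence, `U ^ q(m)` sends both x and U^q(n) x near y, so y =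
x. -/
lemma tendsto_zpow_eval_of_totallyBounded [CompleteSpace H] (hp : IsEssentialIdempotent p)
    (U : H ≃ₗᵢ[ℝ] H) {x : H} (hx : TotallyBounded (Set.range fun n : ℤ => (U ^ n) x))
    (q : ℤ[X]) (hq : q.eval 0 = 0) :
    Tendsto (fun n => (U ^ q.eval n) x) p (𝓝 x) := by
  induction hd : q.natDegree using Nat.strong_induction_on generalizing q with
  | _ d ih =>
  rcases Nat.eq_zero_or_pos d with rfl | hdpos
  · have : q = 0 := by
      rw [eq_C_of_natDegree_eq_zero hd, eval_C] at hq
      rw [eq_C_of_natDegree_eq_zero hd, hq, C_0]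
    simp [this]
  have hr : ∀ m, Tendsto (fun n => (U ^ (taylor m q - q - C (q.eval m)).eval n) x) p (𝓝 x) := by
    intro m
    refine ih _ ?_ _ ?_ rfl
    · rw [natDegree_sub_C]
      have := natDegree_taylor_sub_taylor_lt (hd ▸ hdpos) m 0
      rwa [taylor_zero, hd] at this
    · simp [taylor_eval, hq]
  obtain ⟨y, hy⟩ : ∃ y, Tendsto (fun n => (U ^ q.eval n) x) p (𝓝 y) :=
    CompleteSpace.complete (totallyBounded_iff_ultrafilter.1 hx
      (p.map fun n => (U ^ q.eval n) x) (by
        rw [le_principal_iff]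
        exact Filter.mem_map.2 (Filter.Eventually.of_forall fun n => ⟨_, rfl⟩)))
  suffices y = x by rwa [this] at hy
  refine eq_of_forall_dist_le fun ε hε => ?_
  have h1 := Metric.tendsto_nhds.1 hy (ε / 5) (by positivity)
  obtain ⟨m, hm1, hm2⟩ := (h1.and (hp.eventually_add h1)).exists
  obtain ⟨n, hn1, hn2, hn3⟩ :=
    (h1.and (hm2.and (Metric.tendsto_nhds.1 (hr m) (ε / 5) (by positivity)))).exists
  have e : (U ^ q.eval (m + n)) x =
      (U ^ q.eval m) ((U ^ q.eval n) ((U ^ (taylor m q - q - C (q.eval m)).eval n) x)) := by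
    rw [← U.zpow_add_apply, ← U.zpow_add_apply]
    congr 2
    simp only [eval_sub, taylor_eval, eval_C, add_comm n m]
    ring
  rw [e] at hn2
  have d1 := dist_triangle y ((U ^ q.eval n) x) x
  have d2 : dist ((U ^ q.eval n) x) x =
      dist ((U ^ q.eval m) ((U ^ q.eval n) x)) ((U ^ q.eval m) x) := ((U ^ q.eval m).dist_map _ _).symm
  have d3 : dist ((U ^ (taylor m q - q - C (q.eval m)).eval n) x) x = dist
      ((U ^ q.eval m) ((U ^ q.eval n) ((U ^ (taylor m q - q - C (q.eval m)).eval n) x)))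
      ((U ^ q.eval m) ((U ^ q.eval n) x)) := by
    rw [(U ^ q.eval m).dist_map, (U ^ q.eval n).dist_map]
  have d4 := dist_triangle4 ((U ^ q.eval m) ((U ^ q.eval n) x))
    ((U ^ q.eval m) ((U ^ q.eval n) ((U ^ (taylor m q - q - C (q.eval m)).eval n) x))) y
    ((U ^ q.eval m) x)
  rw [dist_comm] at hn1 hm1
  rw [d3, dist_comm] at hn3
  linarith

end IsEssentialIdempotent

lemma LinearIsometryEquiv.zpow_apply_of_apply_eq (U : H ≃ₗᵢ[ℝ] H) {e : H} (he : U e = e) (n : ℤ) :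
    (U ^ n) e = e := by
  induction n with
  | zero => rfl
  | succ i ih => rw [U.zpow_add_apply, zpow_one, he, ih]
  | pred i ih =>
    nth_rw 1 [← he]
    rw [← zpow_one U, ← zpow_mul, one_mul, ← U.zpow_add_apply, sub_add_cancel, ih]

lemma LinearIsometryEquiv.totallyBounded_orbit_of_zpow (U : H ≃ₗᵢ[ℝ] H) {k : ℤ} (hk : k ≠ 0)
    {x : H} (hx : TotallyBounded (Set.range fun n : ℤ => ((U ^ k) ^ n) x)) :
    TotallyBounded (Set.range fun n : ℤ => (U ^ n) x) := by
  have h : TotallyBounded (⋃ r ∈ Set.Ico 0 |k|,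
      (fun y => (U ^ r) y) '' Set.range fun n : ℤ => ((U ^ k) ^ n) x) :=
    (totallyBounded_biUnion (Set.finite_Ico 0 |k|)).2 fun r _ =>
      hx.image (U ^ r).isometry.uniformContinuous
  refine h.subset ?_
  rintro _ ⟨n, rfl⟩
  refine Set.mem_biUnion ⟨Int.emod_nonneg n hk, Int.emod_lt_abs n hk⟩
    ⟨_, ⟨n / k, rfl⟩, ?_⟩
  simp only
  rw [← U.zpow_mul_apply, ← U.zpow_add_apply, Int.emod_add_mul_ediv]

/-- The subspace of vectors which the powers of `U` return to along the ultrafilter `p`. -/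
def recurrentSubspace (p : Ultrafilter ℤ) (U : H ≃ₗᵢ[ℝ] H) : Submodule ℝ H where
  carrier := {x | Tendsto (fun n : ℤ => (U ^ n) x) p (𝓝 x)}
  add_mem' {x y} hx hy := by
    simpa only [Set.mem_ofPred_eq, map_add] using Tendsto.add hx hy
  zero_mem' := by simp
  smul_mem' c x hx := by
    simpa only [Set.mem_ofPred_eq, map_smul] using Tendsto.const_smul hx c

lemma mem_recurrentSubspace {p : Ultrafilter ℤ} {U : H ≃ₗᵢ[ℝ] H} {x : H} :
    x ∈ recurrentSubspace p U ↔ Tendsto (fun n : ℤ => (U ^ n) x) p (𝓝 x) := Iff.rfl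

lemma isClosed_recurrentSubspace (p : Ultrafilter ℤ) (U : H ≃ₗᵢ[ℝ] H) :
    IsClosed (recurrentSubspace p U : Set H) := by
  refine isClosed_of_closure_subset fun x hx => Metric.tendsto_nhds.2 fun ε hε => ?_
  obtain ⟨z, hz, hxz⟩ := Metric.mem_closure_iff.1 hx (ε / 3) (by positivity)
  filter_upwards [Metric.tendsto_nhds.1 (mem_recurrentSubspace.1 hz) (ε / 3) (by positivity)]
    with n hn
  have h1 := dist_triangle4 ((U ^ n) x) ((U ^ n) z) z x
  rw [(U ^ n).dist_map, dist_comm z x] at h1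
  linarith

instance [CompleteSpace H] (p : Ultrafilter ℤ) (U : H ≃ₗᵢ[ℝ] H) :
    CompleteSpace (recurrentSubspace p U) :=
  (isClosed_recurrentSubspace p U).completeSpace_coe

lemma zpow_mem_recurrentSubspace {p : Ultrafilter ℤ} {U : H ≃ₗᵢ[ℝ] H} {x : H}
    (hx : x ∈ recurrentSubspace p U) (a : ℤ) : (U ^ a) x ∈ recurrentSubspace p U := by
  rw [mem_recurrentSubspace] at hx ⊢
  refine (((U ^ a).continuous.tendsto x).comp hx).congr fun n => ?_
  simp only [Function.comp]
  rw [← U.zpow_add_apply, ← U.zpow_add_apply, add_comm]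

namespace IsEssentialIdempotent

variable {p : Ultrafilter ℤ}

/-- Idempotence gives ⟪V^m y, y⟫ → ⟪y, y⟫; since ‖V^m y‖ = ‖y‖, this forces norm convergence. -/
lemma tendsto_inner_zpow_of_tendsto_inner_zpow (hp : IsEssentialIdempotent p)
    (V : H ≃ₗᵢ[ℝ] H) {x y : H}
    (h : ∀ z, Tendsto (fun n : ℤ => ⟪(V ^ n) x, z⟫) p (𝓝 ⟪y, z⟫)) :
    Tendsto (fun n : ℤ => (V ^ n) y) p (𝓝 y) := by
  have hweak : Tendsto (fun n : ℤ => ⟪(V ^ n) y, y⟫) p (𝓝 ⟪y, y⟫) := by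
    refine Metric.nhds_basis_closedBall.tendsto_right_iff.2 fun ε hε => ?_
    filter_upwards [hp.eventually_add (Metric.tendsto_nhds.1 (h y) ε hε)] with m hm
    have h2 := h ((V ^ (-m)) y)
    simp only [← V.inner_zpow_left, ← V.zpow_add_apply] at h2
    exact le_of_tendsto (h2.dist tendsto_const_nhds) (hm.mono fun n hn => hn.le)
  have hsq : Tendsto (fun n : ℤ => ‖(V ^ n) y - y‖ ^ 2) p (𝓝 0) := by
    have : Tendsto (fun n : ℤ => 2 * ⟪y, y⟫ - 2 * ⟪(V ^ n) y, y⟫) p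
        (𝓝 (2 * ⟪y, y⟫ - 2 * ⟪y, y⟫)) := tendsto_const_nhds.sub (hweak.const_mul 2)
    rw [sub_self] at this
    refine this.congr fun n => ?_
    rw [norm_sub_sq_real, (V ^ n).norm_map, real_inner_self_eq_norm_sq]
    ring
  rw [tendsto_iff_norm_sub_tendsto_zero]
  simpa using hsq.sqrt

variable [CompleteSpace H]

lemma tendsto_zpow_eval (hp : IsEssentialIdempotent p) {U : H ≃ₗᵢ[ℝ] H} {x : H}
    (hx : x ∈ recurrentSubspace p U) (q : ℤ[X]) (hq : q.eval 0 = 0) :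
    Tendsto (fun n => (U ^ q.eval n) x) p (𝓝 x) :=
  hp.tendsto_zpow_eval_of_totallyBounded U (hp.totallyBounded_orbit U hx) q hq

/-- A weak limit y of U^(kn) x is recurrent for U^k, so its U-orbit is precompact and y ∈ K. But x ⊥
K, so y ⊥ y. -/
lemma tendsto_inner_zpow_mul_zero (hp : IsEssentialIdempotent p) {U : H ≃ₗᵢ[ℝ] H} {x : H}
    (hx : x ∈ (recurrentSubspace p U)ᗮ) {k : ℤ} (hk : k ≠ 0) (z : H) :
    Tendsto (fun n => ⟪(U ^ (k * n)) x, z⟫) p (𝓝 0) := by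
  obtain ⟨y, hy⟩ := p.exists_tendsto_inner (v := fun n : ℤ => ((U ^ k) ^ n) x) (C := ‖x‖)
    fun n => ((U ^ k) ^ n).norm_map x |>.le
  have hyK : y ∈ recurrentSubspace p U := by
    have h1 := hp.tendsto_inner_zpow_of_tendsto_inner_zpow (U ^ k) hy
    have h2 := U.totallyBounded_orbit_of_zpow hk (hp.totallyBounded_orbit _ h1)
    simpa [mem_recurrentSubspace] using hp.tendsto_zpow_eval_of_totallyBounded U h2 X eval_X
  have hyy : ⟪y, y⟫ = 0 := by
    refine tendsto_nhds_unique (hy y) (tendsto_const_nhds.congr fun n => ?_)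
    rw [← U.zpow_mul_apply, U.inner_zpow_left]
    exact (Submodule.inner_left_of_mem_orthogonal (zpow_mem_recurrentSubspace hyK _) hx).symm
  have hz := hy z
  rw [inner_self_eq_zero.1 hyy, inner_zero_left] at hz
  simpa only [U.zpow_mul_apply] using hz

/-- Van der Corput replaces q by q(n + a) − q(n + b), of smaller but positive degree, down to the
linear case. -/
lemma tendsto_inner_zpow_eval_zero (hp : IsEssentialIdempotent p) {U : H ≃ₗᵢ[ℝ] H} {x : H}
    (hx : x ∈ (recurrentSubspace p U)ᗮ) (q : ℤ[X]) (hq : 0 < q.natDegree) (z : H) :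
    Tendsto (fun n => ⟪(U ^ q.eval n) x, z⟫) p (𝓝 0) := by
  induction hd : q.natDegree using Nat.strong_induction_on generalizing q z with
  | _ d ih =>
  rcases (show q.natDegree ≤ 1 ∨ 2 ≤ q.natDegree by omega) with hq1 | hq2
  · have hk : q.coeff 1 ≠ 0 := by
      rw [show 1 = q.natDegree by omega]
      exact leadingCoeff_ne_zero.2 (by rintro rfl; simp at hq)
    refine (hp.tendsto_inner_zpow_mul_zero hx hk ((U ^ (-q.coeff 0)) z)).congr fun n => ?_
    rw [← U.inner_zpow_left, ← U.zpow_add_apply]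
    conv_rhs => rw [eq_X_add_C_of_natDegree_le_one hq1]
    simp [add_comm]
  · refine hp.tendsto_inner_zero_of_correlations (C := ‖x‖) (fun n => ((U ^ _).norm_map x).le)
      (fun a b hab => ?_) z
    refine (ih _ (hd ▸ natDegree_taylor_sub_taylor_lt hq a b) (taylor a q - taylor b q)
      (natDegree_taylor_sub_taylor_pos hq2 hab) x rfl).congr fun n => ?_
    rw [eval_sub, taylor_eval, taylor_eval, sub_eq_neg_add, U.zpow_add_apply, U.inner_zpow_left,
      neg_neg, add_comm a, add_comm b]

/-- Along an essential idempotent, polynomial self-correlations of `f` are asymptotically at least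
the square of its inner product with any invariant unit vector. -/
lemma eventually_lt_inner_zpow_eval (hp : IsEssentialIdempotent p) (U : H ≃ₗᵢ[ℝ] H) {e : H}
    (he : U e = e) (he1 : ‖e‖ ≤ 1) (f : H) (q : ℤ[X]) (hq : q.eval 0 = 0) {ε : ℝ} (hε : 0 < ε) :
    ∀ᶠ n in p, ⟪e, f⟫ ^ 2 - ε < ⟪(U ^ q.eval n) f, f⟫ := by
  have hsq : ∀ g : H, ⟪e, g⟫ ^ 2 ≤ ⟪g, g⟫ := fun g => by
    rw [real_inner_self_eq_norm_sq, ← sq_abs]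
    refine pow_le_pow_left₀ (abs_nonneg _) ((abs_real_inner_le_norm _ _).trans ?_) 2
    exact mul_le_of_le_one_left (norm_nonneg _) he1
  rcases Nat.eq_zero_or_pos q.natDegree with h0 | hpos
  · have : q = 0 := by
      rw [eq_C_of_natDegree_eq_zero h0, eval_C] at hq
      rw [eq_C_of_natDegree_eq_zero h0, hq, C_0]
    refine Filter.Eventually.of_forall fun n => ?_
    have := hsq f
    simp only [‹q = 0›, eval_zero, zpow_zero, LinearIsometryEquiv.coe_one, id]
    linarith
  set K := recurrentSubspace p U
  set a := K.starProjection f with ha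
  have haK : a ∈ K := K.starProjection_apply_mem f
  have hbK : f - a ∈ Kᗮ := Submodule.sub_starProjection_mem_orthogonal f
  have heK : e ∈ K := by
    exact tendsto_const_nhds.congr fun n => (U.zpow_apply_of_apply_eq he n).symm
  have h1 : ⟪e, f⟫ = ⟪e, a⟫ := by
    rw [← sub_eq_zero, ← inner_sub_right]
    exact Submodule.inner_right_of_mem_orthogonal heK hbK
  have h2 : ⟪a, f⟫ = ⟪a, a⟫ := by
    rw [← sub_eq_zero, ← inner_sub_right]
    exact Submodule.inner_right_of_mem_orthogonal haK hbK
  have hlim : Tendsto (fun n => ⟪(U ^ q.eval n) f, f⟫) p (𝓝 ⟪a, a⟫) := by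
    have h3 := ((hp.tendsto_zpow_eval haK q hq).inner tendsto_const_nhds (g := fun _ => f)).add
      (hp.tendsto_inner_zpow_eval_zero hbK q hpos f)
    rw [h2, add_zero] at h3
    refine h3.congr fun n => ?_
    rw [← inner_add_left, ← map_add, add_sub_cancel]
  refine hlim.eventually_const_lt ?_
  rw [h1]
  linarith [hsq a]

end IsEssentialIdempotent

end HilbertSpace

open MeasureTheory

/-! ### The Koopman operator and the conclusion -/

section Koopman

variable {X : Type*} [MeasurableSpace X] {μ : Measure X}

/-- The Koopman operator of an invertible measure-preserving transformation on `L²`. -/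
noncomputable def koopman (T : X ≃ᵐ X) (hT : MeasurePreserving T μ μ) :
    Lp ℝ 2 μ ≃ₗᵢ[ℝ] Lp ℝ 2 μ :=
  LinearIsometryEquiv.ofSurjective (Lp.compMeasurePreservingₗᵢ ℝ T hT) fun g =>
    ⟨Lp.compMeasurePreserving T.symm (hT.symm T) g, by
      change Lp.compMeasurePreserving T hT (Lp.compMeasurePreserving T.symm (hT.symm T) g) = g
      rw [← Lp.compMeasurePreserving_comp_apply]
      convert Lp.compMeasurePreserving_id_apply g
      simp⟩

variable [IsFiniteMeasure μ]

lemma koopman_indicatorConstLp (T : X ≃ᵐ X) (hT : MeasurePreserving T μ μ) {A : Set X}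
    (hA : MeasurableSet A) :
    koopman T hT (indicatorConstLp 2 hA (measure_ne_top μ A) (1 : ℝ)) =
      indicatorConstLp 2 (T.measurable hA) (measure_ne_top μ _) 1 :=
  Lp.indicatorConstLp_compMeasurePreserving hA (measure_ne_top μ A) 1 hT

/-- Measurability is bundled in because the right-hand side needs it as an argument, and both come
from one induction. -/
lemma exists_koopman_zpow_indicatorConstLp (T : X ≃ᵐ X) (hT : MeasurePreserving T μ μ) {A : Set X}
    (hA : MeasurableSet A) (n : ℤ) :
    ∃ h : MeasurableSet (⇑((T.toEquiv : Equiv.Perm X) ^ n) ⁻¹' A),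
      (koopman T hT ^ n) (indicatorConstLp 2 hA (measure_ne_top μ A) (1 : ℝ)) =
        indicatorConstLp 2 h (measure_ne_top μ _) 1 := by
  induction n with
  | zero => exact ⟨hA, rfl⟩
  | succ i ih =>
    obtain ⟨h, e⟩ := ih
    have hs : ⇑((T.toEquiv : Equiv.Perm X) ^ ((i : ℤ) + 1)) ⁻¹' A =
        T ⁻¹' (⇑((T.toEquiv : Equiv.Perm X) ^ (i : ℤ)) ⁻¹' A) := by
      rw [zpow_add_one]; rfl
    have hm := T.measurable h
    rw [← hs] at hm
    refine ⟨hm, ?_⟩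
    have : ∀ x, (koopman T hT ^ ((i : ℤ) + 1)) x =
        koopman T hT ((koopman T hT ^ (i : ℤ)) x) := fun x => by
      rw [← mul_self_zpow]; rfl
    rw [this, e, koopman_indicatorConstLp]
    congr 1
  | pred i ih =>
    obtain ⟨h, e⟩ := ih
    have hs : ⇑((T.toEquiv : Equiv.Perm X) ^ (-(i : ℤ) - 1)) ⁻¹' A =
        T.symm ⁻¹' (⇑((T.toEquiv : Equiv.Perm X) ^ (-(i : ℤ))) ⁻¹' A) := by
      rw [zpow_sub_one]; rfl
    have hm := T.symm.measurable h
    rw [← hs] at hm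
    refine ⟨hm, ?_⟩
    apply (koopman T hT).injective
    rw [koopman_indicatorConstLp]
    have : ∀ x, koopman T hT ((koopman T hT ^ (-(i : ℤ) - 1)) x) =
        (koopman T hT ^ (-(i : ℤ))) x := fun x => by
      conv_rhs => rw [← sub_add_cancel (-(i : ℤ)) 1, ← mul_self_zpow]
      rfl
    rw [this, e]
    congr 1
    rw [hs, ← Set.preimage_comp]
    simp

end Koopman

theorem theorem1p1 {X : Type*} [MeasurableSpace X] (μ : MeasureTheory.Measure X)
    [MeasureTheory.IsProbabilityMeasure μ]
    (T : X ≃ᵐ X) (hT : MeasureTheory.MeasurePreserving T μ μ)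
    (A : Set X) (hA : MeasurableSet A)
    (l : ℕ) (P : Fin l → Polynomial ℤ) (hP : ∀ i, (P i).eval 0 = 0)
    (ε : ℝ) (hε : 0 < ε) :
    ∃ n : ℕ, 1 ≤ n ∧ ∀ i : Fin l,
      μ.real (A ∩ ⇑((T.toEquiv : Equiv.Perm X) ^ ((P i).eval (n : ℤ))) ⁻¹' A)
        > μ.real A ^ 2 - ε := by
  obtain ⟨p, hp⟩ := exists_isEssentialIdempotent
  set f : Lp ℝ 2 μ := indicatorConstLp 2 hA (measure_ne_top μ A) (1 : ℝ) with hf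
  set e : Lp ℝ 2 μ := indicatorConstLp 2 MeasurableSet.univ (measure_ne_top μ _) (1 : ℝ) with he
  have he_inv : koopman T hT e = e := koopman_indicatorConstLp T hT MeasurableSet.univ
  have he1 : ‖e‖ ≤ 1 := by
    rw [he, norm_indicatorConstLp (by norm_num) (by norm_num)]
    simp
  have hef : inner ℝ e f = μ.real A := by
    rw [he, hf, L2.real_inner_indicatorConstLp_one_indicatorConstLp_one]
    simp
  have hev : ∀ᶠ n in p, ∀ i, (inner ℝ e f) ^ 2 - ε <
      inner ℝ ((koopman T hT ^ (P i).eval n) f) f :=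
    eventually_all.2 fun i => hp.eventually_lt_inner_zpow_eval _ he_inv he1 f (P i) (hP i) hε
  -- Members of `p` are unbounded above, which makes n positive.
  obtain ⟨n, hn, hn0⟩ := not_bddAbove_iff.1 (hp.not_bddAbove hev) 0
  lift n to ℕ using hn0.le
  refine ⟨n, by exact_mod_cast hn0, fun i => ?_⟩
  have h := hn i
  obtain ⟨hm, e1⟩ := exists_koopman_zpow_indicatorConstLp T hT hA ((P i).eval (n : ℤ))
  rw [hef, e1, hf, L2.real_inner_indicatorConstLp_one_indicatorConstLp_one, Set.inter_comm] at h
  exact h
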